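/- Let $1\le p<\infty$, let $D\subset\mathbb R^d$ be bounded and measurable, let $U=\mathbb R^N$ with the Euclidean norm, and let $\mu,\tilde\mu$ be Borel probability measures on $L^p(D;U)$ with finite $p$-th moments, $\int\|u\|_{L^p}^p\,d\mu(u)<\infty$ and $\int\|u\|_{L^p}^p\,d\tilde\mu(u)<\infty$. A correlation measure is a family $\boldsymbol\nu=(\nu^k)_{k\ge1}$ of maps $x\mapsto\nu^k_x$ from $D^k$ to measures on $U^k$ such that 1. $\nu^k_x$ is a probability measure for a.e. $x\in D^k$, and $x\mapsto\int f\,d\nu^k_x$ is Lebesgue measurable for every $f\in C_b(U^k)$; 2. (symmetry) for every permutation $\sigma$ of $\{1,\dots,k\}$ and $f\in C_0(U^k)$, $\int f(\xi)\,d\nu^k_{\sigma(x)}(\xi)=\int f(\sigma(\xi))\,d\nu^k_x(\xi)$ for a.e. $x\in D^k$, where $\sigma(x)=(x_{\sigma(1)},\dots,x_{\sigma(k)})$; 3. (consistency) for every $k\ge1$ and $g\in C_0(U^k)$, $\int g(\xi_1,\dots,\xi_k)\,d\nu^{k+1}_{x_1,\dots,x_{k+1}}(\xi)=\int g\,d\nu^k_{x_1,\dots,x_k}$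 for a.e. $x\in D^{k+1}$; 4. ($L^p$ integrability) $\int_D\int_U|\xi|^p\,d\nu^1_x(\xi)\,dx<\infty$; 5. (diagonal continuity) $\displaystyle\lim_{r\downarrow0}\int_D\frac1{|B_r(x)\cap D|}\int_{B_r(x)\cap D}\int_{U^2}|\xi_1-\xi_2|^p\,d\nu^2_{x,y}(\xi)\,dy\,dx=0$. It corresponds to (is dual to) $\mu$ if, for all $k\ge1$ and all $g\in L^1(D^k;C_0(U^k))$, $$\int_{D^k}\int_{U^k}g(x,\xi)\,d\nu^k_x(\xi)\,dx=\int_{L^p(D;U)}\int_{D^k}g\big(x_1,\dots,x_k,u(x_1),\dots,u(x_k)\big)\,dx\,d\mu(u).$$ For Borel probability measures $\alpha,\beta$ on a separable Banach space $X$, let $$W_p(\alpha,\beta)=\Big(\inf_\pi\int_{X\times X}\|x-y\|^p\,d\pi(x,y)\Big)^{1/p}\in[0,\infty],$$ where $\pi$ runs over the probability measures on $X\times X$ with marginals $\alpha$ and $\beta$. Let $U^k$ carry the norm $\big(\sum_{l=1}^k|\xi_l|^q\big)^{1/q}$ for some $q\in[1,\infty]$ (the maximum of the $|\xi_l|$ if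 $q=\infty$; $q=2$ gives the Euclidean norm). If $\boldsymbol\nu,\tilde{\boldsymbol\nu}$ are correlation measures corresponding to $\mu,\tilde\mu$, then for every $k\ge1$ the function $x\mapsto W_p(\nu^k_x,\tilde\nu^k_x)$ is Lebesgue measurable on $D^k$, and $$\left(\int_{D^k}W_p\big(\nu^k_x,\tilde\nu^k_x\big)^p\,dx\right)^{1/p}\le C\,W_p(\mu,\tilde\mu)$$ with a finite constant $C=C(p,k,|D|)$ that depends only on $p$, $k$ and the Lebesgue measure $|D|$ of $D$. -/

import Mathlib

open MeasureTheory Filter Topology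
open scoped ENNReal NNReal ZeroAtInfty

/-- The Borel `σ`-algebra on the space `L^p`. -/
noncomputable instance instMeasurableSpaceLp {α E : Type*} {m : MeasurableSpace α} [NormedAddCommGroup E]
    {p : ℝ≥0∞} [Fact (1 ≤ p)] {μ : Measure α} : MeasurableSpace (Lp E p μ) :=
  borel _

instance instBorelSpaceLp {α E : Type*} {m : MeasurableSpace α} [NormedAddCommGroup E]
    {p : ℝ≥0∞} [Fact (1 ≤ p)] {μ : Measure α} : BorelSpace (Lp E p μ) :=
  ⟨rfl⟩

/-- `π` is a transport plan from `μ` to `ρ`: its two marginals are `μ` and `ρ`. -/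
def IsTransportPlan {X : Type*} [MeasurableSpace X] (π : Measure (X × X)) (μ ρ : Measure X) :
    Prop :=
  π.map Prod.fst = μ ∧ π.map Prod.snd = ρ

/-- The `p`-Wasserstein distance
`W_p(μ, ρ) = (inf_π ∫ |x - y|^p dπ(x, y))^(1/p)`, the infimum being over all transport plans,
with values in `[0, ∞]`. -/
noncomputable def wasserstein {X : Type*} [NormedAddCommGroup X] [MeasurableSpace X] (p : ℝ)
    (μ ρ : Measure X) : ℝ≥0∞ :=
  (⨅ (π : Measure (X × X)) (_ : IsTransportPlan π μ ρ),
    ∫⁻ z, ‖z.1 - z.2‖ₑ ^ p ∂π) ^ (1 / p)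

/-- Lebesgue measure on `D^k = D × ⋯ × D`. -/
noncomputable def volPow {d : ℕ} (D : Set (EuclideanSpace ℝ (Fin d))) (k : ℕ) :
    Measure (Fin k → EuclideanSpace ℝ (Fin d)) :=
  Measure.pi fun _ => volume.restrict D

/-- The space `L^p(D; ℝ^N)`. -/
abbrev LpDom {d : ℕ} (D : Set (EuclideanSpace ℝ (Fin d))) (N : ℕ) (p : ℝ≥0∞) : Type :=
  Lp (EuclideanSpace ℝ (Fin N)) p (volume.restrict D)

/-- A family `ν^k_x` of measures on `U^k`, `U = ℝ^N`, indexed by `k` and `x ∈ (ℝ^d)^k`. Only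
`k ≥ 1` and almost every `x ∈ D^k` are relevant below. -/
abbrev MarginalFamily (d N : ℕ) : Type :=
  (k : ℕ) → (Fin k → EuclideanSpace ℝ (Fin d)) → Measure (Fin k → EuclideanSpace ℝ (Fin N))

/-- The modulus of continuity
`ω_r^p(ν²) = ∫_D ⨍_{B_r(x) ∩ D} ⟨ν²_{x,y}, |ξ₁ - ξ₂|^p⟩ dy dx`. -/
noncomputable def modulusOfContinuity {d N : ℕ} (D : Set (EuclideanSpace ℝ (Fin d))) (p : ℝ)
    (ν : MarginalFamily d N) (r : ℝ) : ℝ≥0∞ :=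
  ∫⁻ x in D, (⨍⁻ y, (∫⁻ ξ, ‖ξ 0 - ξ 1‖ₑ ^ p ∂(ν 2 ![x, y]))
    ∂(volume.restrict (Metric.ball x r ∩ D)))

/-- Correlation measures from `D ⊆ ℝ^d` to `U = ℝ^N`, with exponent `p`. -/
structure IsCorrelationMeasure {d N : ℕ} (D : Set (EuclideanSpace ℝ (Fin d))) (p : ℝ)
    (ν : MarginalFamily d N) : Prop where
  /-- Almost every `ν^k_x` is a probability measure. -/
  prob : ∀ k, 1 ≤ k → ∀ᵐ x ∂(volPow D k), IsProbabilityMeasure (ν k x)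
  /-- `x ↦ ⟨ν^k_x, f⟩` is Lebesgue measurable on `D^k` for every `f ∈ C_b(U^k)`. -/
  meas : ∀ k, 1 ≤ k →
    ∀ f : BoundedContinuousFunction (Fin k → EuclideanSpace ℝ (Fin N)) ℝ,
      AEMeasurable (fun x => ∫ ξ, f ξ ∂(ν k x)) (volPow D k)
  /-- Symmetry: permuting the points permutes the values. -/
  symm : ∀ k, 1 ≤ k → ∀ (σ : Equiv.Perm (Fin k)) (f : C₀(Fin k → EuclideanSpace ℝ (Fin N), ℝ)),
    ∀ᵐ x ∂(volPow D k), ∫ ξ, f ξ ∂(ν k (x ∘ σ)) = ∫ ξ, f (ξ ∘ σ) ∂(ν k x)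
  /-- Consistency: dropping the last point gives the previous marginal. -/
  consistent : ∀ k, 1 ≤ k → ∀ g : C₀(Fin k → EuclideanSpace ℝ (Fin N), ℝ),
    ∀ᵐ x ∂(volPow D (k + 1)),
      ∫ ξ, g (fun i => ξ i.castSucc) ∂(ν (k + 1) x) = ∫ ξ, g ξ ∂(ν k fun i => x i.castSucc)
  /-- `L^p` integrability. -/
  integrable : ∫⁻ x in D, ∫⁻ ξ, ‖ξ 0‖ₑ ^ p ∂(ν 1 fun _ => x) < ∞
  /-- Diagonal continuity. -/
  diagonal : Tendsto (modulusOfContinuity D p ν) (𝓝[>] 0) (𝓝 0)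

/-- The family `ν` is dual to the measure `μ` on `L^p(D; U)`:
`∫_{D^k} ⟨ν^k_x, g(x)⟩ dx = ∫_{L^p} ∫_{D^k} g(x, u(x)) dx dμ(u)`
for all `k ≥ 1` and all `g ∈ L¹(D^k, C₀(U^k))`. -/
def IsDualTo {d N : ℕ} (D : Set (EuclideanSpace ℝ (Fin d))) (p : ℝ≥0∞) [Fact (1 ≤ p)]
    (ν : MarginalFamily d N) (μ : Measure (LpDom D N p)) : Prop :=
  ∀ k, 1 ≤ k →
    ∀ g : (Fin k → EuclideanSpace ℝ (Fin d)) → C₀(Fin k → EuclideanSpace ℝ (Fin N), ℝ),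
      Integrable g (volPow D k) →
        ∫ x, ∫ ξ, g x ξ ∂(ν k x) ∂(volPow D k) =
          ∫ u, ∫ x, g x (fun i => u (x i)) ∂(volPow D k) ∂μ

/-- The `p`-Wasserstein distance on `U^k`, `U = ℝ^N`, where `U^k` carries the norm
`|ξ| = (∑ l, |ξ_l|^q)^(1/q)` (the maximum of the `|ξ_l|` for `q = ∞`); the norm of
`ℝ^N` is Euclidean, so `q = 2` is the Euclidean norm of `U^k = ℝ^(kN)`. -/
noncomputable def wassersteinPow {k N : ℕ} (q : ℝ≥0∞) [Fact (1 ≤ q)] (p : ℝ)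
    (ν ρ : Measure (Fin k → EuclideanSpace ℝ (Fin N))) : ℝ≥0∞ :=
  wasserstein (X := PiLp q fun _ : Fin k => EuclideanSpace ℝ (Fin N)) p
    (ν.map (WithLp.toLp q)) (ρ.map (WithLp.toLp q))

/-! Fix a jointly measurable representative Φ(x, u) of u(x). Testing duality against 1_A(x) f(ξ) and
applying Fubini identifies ν^k_x, for a.e. x, with the law of (Φ(x_1, u), …, Φ(x_k, u)) under μ
(`ae_eq_map_evalPow`). A plan π between the measures on L^p is therefore pushed by one and the same
evaluation map to a plan between the k-point marginals at a.e. x. Tonelli, together with |ξ| ≤ ∑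
|ξ_l| and the power mean inequality, bounds ∫ W_p^p dx by k^p |D|^(k-1) times the cost of π
(`lintegral_enorm_evalPow_sub_le`); the infimum over π finishes.

Measurability of the distance in x rests on `measurable_wasserstein_marginals`: sublevel sets of W_p
are countable unions of weakly closed sets, by tightness and lower semicontinuity of the cost. -/

/-! ### Jointly measurable evaluation on L^p. -/

/-- Elements of `L^p` have a jointly measurable evaluation map. -/
theorem exists_measurable_lp_eval {α E : Type*} {m : MeasurableSpace α} [NormedAddCommGroup E]
    [CompleteSpace E] [SecondCountableTopology E] [MeasurableSpace E] [BorelSpace E]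
    {p : ℝ≥0∞} [Fact (1 ≤ p)] (hp : p ≠ ∞) {μ : Measure α} [SecondCountableTopology (Lp E p μ)] :
    ∃ Φ : α × Lp E p μ → E, Measurable Φ ∧ ∀ u : Lp E p μ, ∀ᵐ x ∂μ, Φ (x, u) = u x := by
  classical
  have hp1 : (1 : ℝ≥0∞) ≤ p := Fact.out
  have hp0 : 0 < p.toReal := ENNReal.toReal_pos (zero_lt_one.trans_le hp1).ne' hp
  let d : ℕ → Lp E p μ := TopologicalSpace.denseSeq _
  -- The bounds 2⁻ⁿ are summable, so for each u the whole sequence of approximants converges a.e.,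
  -- with no subsequence depending on u.
  let P : ℕ → Lp E p μ → ℕ → Prop := fun n u j => ‖d j - u‖ₑ ^ p.toReal < 2⁻¹ ^ n
  have hcont : ∀ j, Continuous fun u : Lp E p μ => ‖d j - u‖ₑ ^ p.toReal := fun j =>
    ENNReal.continuous_rpow_const.comp (continuous_const.sub continuous_id).enorm
  have hP : ∀ n u, ∃ j, P n u j := by
    intro n u
    have hc : Continuous fun v : Lp E p μ => ‖v - u‖ₑ ^ p.toReal :=
      ENNReal.continuous_rpow_const.comp (continuous_id.sub continuous_const).enorm
    have ho : IsOpen {v : Lp E p μ | ‖v - u‖ₑ ^ p.toReal < 2⁻¹ ^ n} :=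
      isOpen_lt hc continuous_const
    obtain ⟨_, ⟨hj, j, rfl⟩⟩ := (TopologicalSpace.denseRange_denseSeq (Lp E p μ)).inter_open_nonempty
      _ ho ⟨u, by simp [ENNReal.zero_rpow_of_pos hp0, ENNReal.pow_pos]⟩
    exact ⟨j, hj⟩
  -- Taking the least admissible index makes the choice measurable in u.
  let j : ℕ → Lp E p μ → ℕ := fun n u => Nat.find (hP n u)
  have hj : ∀ n, Measurable (j n) := fun n =>
    measurable_find (hP n) fun k => (isOpen_lt (hcont k) continuous_const).measurableSet
  have hjs : ∀ n u, ‖d (j n u) - u‖ₑ ^ p.toReal < 2⁻¹ ^ n := fun n u => Nat.find_spec (hP n u)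
  let Ψ : ℕ → α × Lp E p μ → E := fun n z => d (j n z.2) z.1
  have hΨ : ∀ n, Measurable (Ψ n) := by
    intro n
    have h : Measurable fun y : α × ℕ => d y.2 y.1 :=
      measurable_from_prod_countable_left fun i => (Lp.stronglyMeasurable (d i)).measurable
    exact h.comp (measurable_fst.prodMk ((hj n).comp measurable_snd))
  refine ⟨fun z => limUnder atTop fun n => Ψ n z,
    (StronglyMeasurable.limUnder fun n => (hΨ n).stronglyMeasurable).measurable, fun u => ?_⟩
  have hmeas : ∀ n, AEMeasurable (fun x => ‖Ψ n (x, u) - u x‖ₑ ^ p.toReal) μ := fun n =>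
    ((((Lp.aestronglyMeasurable (d (j n u))).sub (Lp.aestronglyMeasurable u)).enorm).pow_const _)
  have hint : ∀ n, ∫⁻ x, ‖Ψ n (x, u) - u x‖ₑ ^ p.toReal ∂μ = ‖d (j n u) - u‖ₑ ^ p.toReal := by
    intro n
    rw [Lp.enorm_def, eLpNorm_eq_lintegral_rpow_enorm_toReal (zero_lt_one.trans_le hp1).ne' hp,
      ← ENNReal.rpow_mul, one_div_mul_cancel hp0.ne', ENNReal.rpow_one]
    refine lintegral_congr_ae ?_
    filter_upwards [Lp.coeFn_sub (d (j n u)) u] with x hx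
    rw [hx, Pi.sub_apply]
  have hsum : ∫⁻ x, ∑' n, ‖Ψ n (x, u) - u x‖ₑ ^ p.toReal ∂μ ≠ ∞ := by
    rw [lintegral_tsum hmeas]
    refine ne_top_of_le_ne_top ?_ (ENNReal.tsum_le_tsum fun n => (hint n).trans_le (hjs n u).le)
    rw [ENNReal.tsum_geometric]
    simp
  filter_upwards [ae_lt_top' (AEMeasurable.tsum hmeas) hsum] with x hx
  refine Tendsto.limUnder_eq ?_
  have h0 := ENNReal.tendsto_atTop_zero_of_tsum_ne_top hx.ne
  have h1 : Tendsto (fun n => ‖Ψ n (x, u) - u x‖ₑ) atTop (𝓝 0) := by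
    have := (ENNReal.continuous_rpow_const (y := p.toReal⁻¹)).tendsto 0 |>.comp h0
    simpa [Function.comp_def, ← ENNReal.rpow_mul, hp0.ne', hp0] using this
  rw [tendsto_iff_edist_tendsto_0]
  simpa only [edist_eq_enorm_sub] using h1

/-! ### Weak topology and evaluation σ-algebra on probability measures. -/

/-- Preimages of open sets under a pointwise limit of measurable functions are measurable; no
`σ`-algebra on the target is involved. -/
theorem measurableSet_preimage_of_tendsto {α Y : Type*} [MeasurableSpace α] [TopologicalSpace Y]
    [TopologicalSpace.PseudoMetrizableSpace Y] {f : ℕ → α → Y} {g : α → Y}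
    (hf : ∀ n s, IsOpen s → MeasurableSet (f n ⁻¹' s))
    (hlim : ∀ a, Tendsto (fun n => f n a) atTop (𝓝 (g a))) {s : Set Y} (hs : IsOpen s) :
    MeasurableSet (g ⁻¹' s) := by
  borelize Y
  exact measurable_of_tendsto_metrizable (fun n => measurable_of_isOpen fun s hs => hf n s hs)
    (tendsto_pi_nhds.2 hlim) hs.measurableSet

/-- The law of a simple function depends measurably on the underlying probability measure. -/
theorem measurableSet_preimage_map_simpleFunc {X : Type*} [TopologicalSpace X]
    [MeasurableSpace X] [BorelSpace X] (T : SimpleFunc X X) {s : Set (ProbabilityMeasure X)}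
    (hs : IsOpen s) :
    MeasurableSet ((fun ρ : ProbabilityMeasure X => ρ.map T.measurable.aemeasurable) ⁻¹' s) := by
  classical
  let F := {x // x ∈ T.range}
  -- The law of T is a convex combination of Dirac masses at its finitely many values: it factors
  -- through the simplex of weights, measurably into it and continuously out of it.
  let G : stdSimplex ℝ F → ProbabilityMeasure X := fun w =>
    ⟨∑ i, ENNReal.ofReal (w.1 i) • Measure.dirac i.1, ⟨by
      simp [← ENNReal.ofReal_sum_of_nonneg fun i _ => w.2.1 i, w.2.2]⟩⟩
  have hG : Continuous G := by
    rw [ProbabilityMeasure.continuous_iff_forall_continuous_integral]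
    intro f
    have h : ∀ w, ∫ x, f x ∂(G w : Measure X) = ∑ i, w.1 i * f i.1 := by
      intro w
      simp only [G, ProbabilityMeasure.coe_mk]
      rw [integral_finsetSum_measure]
      · refine Finset.sum_congr rfl fun i _ => ?_
        rw [integral_smul_measure, integral_dirac' _ _ f.continuous.stronglyMeasurable,
          ENNReal.toReal_ofReal (w.2.1 i), smul_eq_mul]
      · intro i _
        exact (f.integrable _).smul_measure ENNReal.ofReal_ne_top
    simp only [h]
    exact continuous_finsetSum _ fun i _ =>
      ((continuous_apply i).comp continuous_subtype_val).mul continuous_const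
  have hT : ∀ ρ : ProbabilityMeasure X, ∑ i : F, (ρ : Measure X).real (T ⁻¹' {i.1}) = 1 := by
    intro ρ
    rw [Finset.sum_coe_sort T.range fun i => (ρ : Measure X).real (T ⁻¹' {i}),
      sum_measureReal_preimage_singleton _ fun _ _ => T.measurableSet_fiber _]
    simp
  let w : ProbabilityMeasure X → stdSimplex ℝ F := fun ρ =>
    ⟨fun i => (ρ : Measure X).real (T ⁻¹' {i.1}), fun i => measureReal_nonneg, hT ρ⟩
  have hw : Measurable w := by
    refine Measurable.subtype_mk (measurable_pi_lambda _ fun i => ?_)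
    exact ((Measure.measurable_coe (T.measurableSet_fiber _)).comp
      measurable_subtype_coe).ennreal_toReal
  have hGw : (fun ρ : ProbabilityMeasure X => ρ.map T.measurable.aemeasurable) = G ∘ w := by
    funext ρ
    refine Subtype.ext (Measure.ext fun t ht => ?_)
    have h1 : T ⁻¹' t = T ⁻¹' ((T.range.filter (· ∈ t) : Finset X) : Set X) := by
      ext x; simp
    have h2 : ∀ i : F, ENNReal.ofReal ((ρ : Measure X).real (T ⁻¹' {i.1})) *
        Measure.dirac i.1 t = if i.1 ∈ t then (ρ : Measure X) (T ⁻¹' {i.1}) else 0 := by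
      intro i
      by_cases hi : i.1 ∈ t <;> simp [hi, ht]
    change (ρ.map T.measurable.aemeasurable : Measure X) t = (∑ i : F,
      ENNReal.ofReal ((ρ : Measure X).real (T ⁻¹' {i.1})) • Measure.dirac i.1 : Measure X) t
    simp only [ProbabilityMeasure.toMeasure_map, Measure.coe_finsetSum, Finset.sum_apply,
      Measure.smul_apply, smul_eq_mul, h2]
    rw [Measure.map_apply T.measurable ht, h1, ← T.sum_measure_preimage_singleton,
      Finset.sum_filter,
      Finset.sum_coe_sort T.range fun i => if i ∈ t then (ρ : Measure X) (T ⁻¹' {i}) else 0]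
  rw [hGw, Set.preimage_comp]
  exact hw (hs.preimage hG).measurableSet

/-- Borel sets of the topology of weak convergence are measurable for the `σ`-algebra generated
by the evaluations. -/
instance opensMeasurableSpace_probabilityMeasure {X : Type*} [TopologicalSpace X]
    [PolishSpace X] [MeasurableSpace X] [BorelSpace X] :
    OpensMeasurableSpace (ProbabilityMeasure X) := by
  rcases isEmpty_or_nonempty X with hX | hX
  · have : IsEmpty (ProbabilityMeasure X) := ⟨fun ρ => hX.elim ρ.nonempty.some⟩
    exact ⟨fun s _ => by simp [Set.eq_empty_of_isEmpty s]⟩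
  let := TopologicalSpace.upgradeIsCompletelyMetrizable X
  let T : ℕ → SimpleFunc X X := fun n =>
    SimpleFunc.approxOn id measurable_id Set.univ hX.some (Set.mem_univ _) n
  have hT : ∀ x, Tendsto (fun n => T n x) atTop (𝓝 x) := fun x =>
    SimpleFunc.tendsto_approxOn (f := id) measurable_id (Set.mem_univ _) (by simp)
  -- Since T n → id pointwise, ρ is the weak limit of its images under T n, so the identity is a
  -- pointwise limit of measurable maps.
  refine ⟨MeasurableSpace.generateFrom_le fun s hs => measurableSet_preimage_of_tendsto (g := id)
    (fun n s hs => measurableSet_preimage_map_simpleFunc (T n) hs) (fun ρ => ?_) hs⟩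
  rw [ProbabilityMeasure.tendsto_iff_forall_integral_tendsto]
  intro f
  have h : ∀ n, ∫ x, f x ∂(ρ.map (T n).measurable.aemeasurable : Measure X) =
      ∫ x, f (T n x) ∂(ρ : Measure X) := fun n => by
    rw [ProbabilityMeasure.toMeasure_map]
    exact integral_map (T n).measurable.aemeasurable f.continuous.aestronglyMeasurable
  simp only [h, id]
  exact tendsto_integral_of_dominated_convergence (fun _ => ‖f‖) (fun n =>
    (f.continuous.measurable.comp (T n).measurable).aestronglyMeasurable) (integrable_const _)
    (fun n => ae_of_all _ fun x => f.norm_coe_le_norm _)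
    (ae_of_all _ fun x => (f.continuous.tendsto x).comp (hT x))

/-! ### Closedness of coupling conditions and measurability of W_p. -/

/-- The integral of a continuous cost is lower semicontinuous for weak convergence. -/
theorem isClosed_lintegral_le {X : Type*} [TopologicalSpace X] [MeasurableSpace X]
    [OpensMeasurableSpace X] {c : X → ℝ≥0} (hc : Continuous c) (s : ℝ≥0∞) :
    IsClosed {π : ProbabilityMeasure X | ∫⁻ z, c z ∂(π : Measure X) ≤ s} := by
  have h : {π : ProbabilityMeasure X | ∫⁻ z, c z ∂(π : Measure X) ≤ s} =
      ⋂ M : ℕ, {π : ProbabilityMeasure X |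
        ∫⁻ z, (min (c z) M : ℝ≥0) ∂(π : Measure X) ≤ s} := by
    ext π
    simp only [Set.mem_ofPred_eq, Set.mem_iInter]
    rw [← iSup_le_iff, ← lintegral_iSup]
    · suffices ∀ z, ⨆ M : ℕ, ((min (c z) M : ℝ≥0) : ℝ≥0∞) = c z by simp only [this]
      intro z
      refine le_antisymm (iSup_le fun M => by simp) ?_
      obtain ⟨M, hM⟩ := exists_nat_ge (c z)
      exact le_iSup_of_le M (by simp [min_eq_left hM])
    · exact fun M => (hc.min continuous_const).measurable.coe_nnreal_ennreal
    · intro M M' hM z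
      simp only
      gcongr
  rw [h]
  refine isClosed_iInter fun M => ?_
  let f : BoundedContinuousFunction X ℝ≥0 :=
    BoundedContinuousFunction.mkOfBound ⟨fun z => min (c z) M, hc.min continuous_const⟩ M
      fun x y => by
        rw [NNReal.dist_eq, abs_le]
        have h1 : ((min (c x) M : ℝ≥0) : ℝ) ≤ M := by exact_mod_cast min_le_right (c x) (M : ℝ≥0)
        have h2 : ((min (c y) M : ℝ≥0) : ℝ) ≤ M := by exact_mod_cast min_le_right (c y) (M : ℝ≥0)
        have h3 := (min (c x) M : ℝ≥0).2
        have h4 := (min (c y) M : ℝ≥0).2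
        constructor <;> simp only [ContinuousMap.coe_mk] <;> linarith!
  exact isClosed_le (ProbabilityMeasure.continuous_lintegral_boundedContinuousFunction f)
    continuous_const

/-- Having the same marginals as a coupling of cost at most `s` is a closed condition. -/
theorem isClosed_exists_coupling_le {X : Type*} [TopologicalSpace X] [PolishSpace X]
    [MeasurableSpace X] [BorelSpace X] {c : X × X → ℝ≥0} (hc : Continuous c) (s : ℝ≥0∞) :
    IsClosed {ρ : ProbabilityMeasure (X × X) | ∃ π : ProbabilityMeasure (X × X),
      π.map measurable_fst.aemeasurable = ρ.map measurable_fst.aemeasurable ∧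
      π.map measurable_snd.aemeasurable = ρ.map measurable_snd.aemeasurable ∧
      ∫⁻ z, c z ∂(π : Measure (X × X)) ≤ s} := by
  let := TopologicalSpace.upgradeIsCompletelyMetrizable X
  refine isSeqClosed_iff_isClosed.1 fun ρ ρ₀ hρ hlim => ?_
  simp only [Set.mem_ofPred_eq] at hρ
  choose π h1 h2 h3 using hρ
  -- A convergent sequence with its limit is compact, hence tight. The couplings inherit tightness
  -- from the shared marginals, and Prokhorov gives a convergent subsequence.
  have hK : IsTightMeasureSet {m | ∃ r ∈ Set.range ρ, (r : Measure (X × X)) = m} := by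
    refine isTightMeasureSet_of_isCompact_closure ?_
    exact hlim.isCompact_insert_range.closure_of_subset (Set.subset_insert _ _)
  have hπ : IsTightMeasureSet {m | ∃ r ∈ Set.range π, (r : Measure (X × X)) = m} := by
    refine IsTightMeasureSet.prodMk ((hK.map continuous_fst).subset ?_)
      ((hK.map continuous_snd).subset ?_)
    · rintro _ ⟨_, ⟨_, ⟨n, rfl⟩, rfl⟩, rfl⟩
      exact ⟨ρ n, ⟨_, ⟨n, rfl⟩, rfl⟩, by
        simpa [Measure.fst] using congrArg ProbabilityMeasure.toMeasure (h1 n).symm⟩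
    · rintro _ ⟨_, ⟨_, ⟨n, rfl⟩, rfl⟩, rfl⟩
      exact ⟨ρ n, ⟨_, ⟨n, rfl⟩, rfl⟩, by
        simpa [Measure.snd] using congrArg ProbabilityMeasure.toMeasure (h2 n).symm⟩
  obtain ⟨π₀, -, φ, hφ, hφlim⟩ := (isCompact_closure_of_isTightMeasureSet hπ).tendsto_subseq
    fun n => subset_closure (Set.mem_range_self n)
  have hlim' := hlim.comp hφ.tendsto_atTop
  refine ⟨π₀, ?_, ?_, (isClosed_lintegral_le hc s).mem_of_tendsto hφlim
    (Eventually.of_forall fun n => h3 _)⟩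
  · refine tendsto_nhds_unique
      (((ProbabilityMeasure.continuous_map continuous_fst).tendsto π₀).comp hφlim) ?_
    exact (((ProbabilityMeasure.continuous_map continuous_fst).tendsto ρ₀).comp hlim').congr
      fun n => (h1 _).symm
  · refine tendsto_nhds_unique
      (((ProbabilityMeasure.continuous_map continuous_snd).tendsto π₀).comp hφlim) ?_
    exact (((ProbabilityMeasure.continuous_map continuous_snd).tendsto ρ₀).comp hlim').congr
      fun n => (h2 _).symm

/-- The Wasserstein distance between the marginals of `ρ` depends measurably on `ρ`. -/
theorem measurable_wasserstein_marginals {X : Type*} [NormedAddCommGroup X] [CompleteSpace X]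
    [SecondCountableTopology X] [MeasurableSpace X] [BorelSpace X] {p : ℝ} (hp : 0 ≤ p) :
    Measurable fun ρ : ProbabilityMeasure (X × X) =>
      wasserstein p ((ρ : Measure (X × X)).map Prod.fst) ((ρ : Measure (X × X)).map Prod.snd) := by
  refine Measurable.pow_const ?_ _
  let c : X × X → ℝ≥0 := fun z => ‖z.1 - z.2‖₊ ^ p
  have hc : Continuous c := (NNReal.continuous_rpow_const hp).comp
    (continuous_fst.sub continuous_snd).nnnorm
  have hcost : ∀ π : Measure (X × X), ∫⁻ z, ‖z.1 - z.2‖ₑ ^ p ∂π = ∫⁻ z, c z ∂π := fun π =>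
    lintegral_congr fun z => by simp [c, enorm_eq_nnnorm, ENNReal.coe_rpow_of_nonneg _ hp]
  simp only [hcost]
  refine measurable_of_Iio fun s => ?_
  -- A rational strictly between some plan's cost and s replaces attainment of the infimum.
  have h : (fun ρ : ProbabilityMeasure (X × X) => ⨅ (π : Measure (X × X))
      (_ : IsTransportPlan π ((ρ : Measure (X × X)).map Prod.fst)
        ((ρ : Measure (X × X)).map Prod.snd)), ∫⁻ z, c z ∂π) ⁻¹' Set.Iio s =
      ⋃ (r : ℚ) (_ : ENNReal.ofReal r < s), {ρ : ProbabilityMeasure (X × X) |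
        ∃ π : ProbabilityMeasure (X × X),
        π.map measurable_fst.aemeasurable = ρ.map measurable_fst.aemeasurable ∧
        π.map measurable_snd.aemeasurable = ρ.map measurable_snd.aemeasurable ∧
        ∫⁻ z, c z ∂(π : Measure (X × X)) ≤ ENNReal.ofReal r} := by
    ext ρ
    simp only [Set.mem_preimage, Set.mem_Iio, iInf_lt_iff, Set.mem_iUnion, Set.mem_ofPred_eq,
      exists_prop]
    constructor
    · rintro ⟨π, ⟨h1, h2⟩, h3⟩
      obtain ⟨r, -, hr1, hr2⟩ := ENNReal.lt_iff_exists_rat_btwn.1 h3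
      have hπ : IsProbabilityMeasure π := by
        have : IsProbabilityMeasure (π.map Prod.fst) := by
          rw [h1]; exact Measure.isProbabilityMeasure_map measurable_fst.aemeasurable
        exact Measure.isProbabilityMeasure_of_map Prod.fst
      exact ⟨r, hr2, ⟨π, hπ⟩, Subtype.ext h1, Subtype.ext h2,
        hr1.le⟩
    · rintro ⟨r, hr, π, h1, h2, h3⟩
      exact ⟨π, ⟨by simpa using congrArg ProbabilityMeasure.toMeasure h1,
        by simpa using congrArg ProbabilityMeasure.toMeasure h2⟩, h3.trans_lt hr⟩
  rw [h]
  exact MeasurableSet.iUnion fun r => MeasurableSet.iUnion fun _ =>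
    (isClosed_exists_coupling_le hc _).measurableSet

/-! ### Identification of the dual correlation measure. -/

/-- The thickened indicator of a compact set, as a function vanishing at infinity. -/
noncomputable def thickenedIndicatorC₀ {Y : Type*} [MetricSpace Y] [ProperSpace Y] {δ : ℝ}
    (hδ : 0 < δ) {K : Set Y} (hK : IsCompact K) : C₀(Y, ℝ) where
  toFun y := thickenedIndicator hδ K y
  continuous_toFun := NNReal.continuous_coe.comp (thickenedIndicator hδ K).continuous
  zero_at_infty' := by
    refine tendsto_const_nhds.congr' ?_
    filter_upwards [(hK.cthickening (r := δ)).compl_mem_cocompact] with y hy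
    rw [thickenedIndicator_zero hδ K fun h => hy (Metric.thickening_subset_cthickening _ _ h)]
    simp

/-- Countably many functions vanishing at infinity determine a probability measure. -/
theorem exists_countable_determining_C₀ (Y : Type*) [MetricSpace Y] [ProperSpace Y]
    [MeasurableSpace Y] [BorelSpace Y] :
    ∃ S : Set C₀(Y, ℝ), S.Countable ∧ ∀ (α β : Measure Y) [IsProbabilityMeasure α]
      [IsProbabilityMeasure β], (∀ f ∈ S, ∫ y, f y ∂α = ∫ y, f y ∂β) → α = β := by
  rcases isEmpty_or_nonempty Y with hY | hY
  · exact ⟨∅, Set.countable_empty, fun α β _ _ _ => Measure.ext fun s _ => by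
      simp [Set.eq_empty_of_isEmpty s]⟩
  let B : ℕ × ℕ → Set Y := fun i =>
    Metric.closedBall (TopologicalSpace.denseSeq Y i.1) (1 / ((i.2 : ℝ) + 1))
  -- Nonempty finite intersections of these balls form a countable π-system of compact sets
  -- generating the Borel sets.
  let I := {s : Finset (ℕ × ℕ) // s.Nonempty}
  let K : I → Set Y := fun s => ⋂ i ∈ s.1, B i
  have hK : ∀ s, IsCompact (K s) := by
    intro s
    obtain ⟨i, hi⟩ := s.2
    exact (isCompact_closedBall _ _).of_isClosed_subset
      (isClosed_biInter fun _ _ => Metric.isClosed_closedBall) (Set.biInter_subset_of_mem hi)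
  have hδ : ∀ n : ℕ, 0 < 1 / ((n : ℝ) + 1) := fun n => Nat.one_div_pos_of_nat
  refine ⟨Set.range fun z : I × ℕ => thickenedIndicatorC₀ (hδ z.2) (hK z.1),
    Set.countable_range _, fun α β _ _ h => ?_⟩
  refine ext_of_generate_finite (Set.range K) ?_ ?_ ?_ (by simp)
  · rw [BorelSpace.measurable_eq (α := Y)]
    refine le_antisymm (MeasurableSpace.generateFrom_le fun U hU => ?_)
      (MeasurableSpace.generateFrom_le ?_)
    · have hUeq : U = ⋃ (i : ℕ × ℕ) (_ : B i ⊆ U), B i := by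
        refine Set.Subset.antisymm (fun y hy => ?_) (Set.iUnion₂_subset fun i hi => hi)
        obtain ⟨ε, hε, hεU⟩ := Metric.isOpen_iff.1 hU y hy
        obtain ⟨n, hn⟩ := exists_nat_one_div_lt (half_pos hε)
        obtain ⟨j, hj⟩ := (TopologicalSpace.denseRange_denseSeq Y).exists_dist_lt y (hδ n)
        refine Set.mem_iUnion₂.2 ⟨(j, n), fun w hw => hεU ?_, Metric.mem_closedBall.2 hj.le⟩
        have := dist_triangle_right w y (TopologicalSpace.denseSeq Y j)
        have hw' := Metric.mem_closedBall.1 hw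
        rw [Metric.mem_ball]
        linarith
      rw [hUeq]
      refine MeasurableSet.iUnion fun i => MeasurableSet.iUnion fun _ =>
        MeasurableSpace.measurableSet_generateFrom ⟨⟨{i}, Finset.singleton_nonempty i⟩, ?_⟩
      simp [K]
    · rintro _ ⟨s, rfl⟩
      exact (borel_eq_generateFrom_isClosed (α := Y)) ▸
        MeasurableSpace.measurableSet_generateFrom (hK s).isClosed
  · rintro _ ⟨s, rfl⟩ _ ⟨t, rfl⟩ -
    exact ⟨⟨s.1 ∪ t.1, s.2.mono Finset.subset_union_left⟩, by
      ext y
      simp [K, or_imp, forall_and]⟩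
  · rintro _ ⟨s, rfl⟩
    have key : ∀ ρ : Measure Y, [IsProbabilityMeasure ρ] → Tendsto (fun n : ℕ => ENNReal.ofReal
        (∫ y, thickenedIndicatorC₀ (hδ n) (hK s) y ∂ρ)) atTop (𝓝 (ρ (K s))) := by
      intro ρ _
      refine (tendsto_lintegral_thickenedIndicator_of_isClosed ρ (hK s).isClosed hδ
        tendsto_one_div_add_atTop_nhds_zero_nat).congr fun n => ?_
      exact lintegral_coe_eq_integral _
        (BoundedContinuousFunction.integrable_of_nnreal ρ (thickenedIndicator (hδ n) (K s)))
    refine tendsto_nhds_unique (key α) ((key β).congr fun n => ?_)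
    rw [h _ ⟨(s, n), rfl⟩]

/-- Identification of a family of probability measures through its integrals over sets. -/
theorem ae_eq_of_setIntegral_C₀_eq {X Y : Type*} [MeasurableSpace X] [MetricSpace Y]
    [ProperSpace Y] [MeasurableSpace Y] [BorelSpace Y] {m : Measure X} [IsFiniteMeasure m]
    {ν κ : X → Measure Y} (hν : ∀ᵐ x ∂m, IsProbabilityMeasure (ν x))
    (hκ : ∀ᵐ x ∂m, IsProbabilityMeasure (κ x))
    (hνm : ∀ f : C₀(Y, ℝ), AEMeasurable (fun x => ∫ y, f y ∂(ν x)) m)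
    (hκm : ∀ f : C₀(Y, ℝ), AEMeasurable (fun x => ∫ y, f y ∂(κ x)) m)
    (h : ∀ (f : C₀(Y, ℝ)) (A : Set X), MeasurableSet A →
      ∫ x in A, ∫ y, f y ∂(ν x) ∂m = ∫ x in A, ∫ y, f y ∂(κ x) ∂m) :
    ∀ᵐ x ∂m, ν x = κ x := by
  obtain ⟨S, hS, hdet⟩ := exists_countable_determining_C₀ Y
  have hint : ∀ (η : X → Measure Y) (f : C₀(Y, ℝ)), (∀ᵐ x ∂m, IsProbabilityMeasure (η x)) →
      AEMeasurable (fun x => ∫ y, f y ∂(η x)) m → Integrable (fun x => ∫ y, f y ∂(η x)) m := by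
    intro η f hη hm
    refine Integrable.of_bound hm.aestronglyMeasurable ‖f‖ ?_
    filter_upwards [hη] with x hx
    refine (norm_integral_le_of_norm_le_const (C := ‖f‖)
      (ae_of_all _ fun y => f.toBCF.norm_coe_le_norm y)).trans ?_
    simp
  -- Countability of S allows a single null set for all test functions.
  have hae : ∀ f ∈ S, ∀ᵐ x ∂m, ∫ y, f y ∂(ν x) = ∫ y, f y ∂(κ x) := fun f _ =>
    Integrable.ae_eq_of_forall_setIntegral_eq _ _ (hint ν f hν (hνm f)) (hint κ f hκ (hκm f))
      fun A hA _ => h f A hA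
  filter_upwards [hν, hκ, (ae_ball_iff hS).2 hae] with x h1 h2 h3
  exact hdet _ _ h3

/-- Evaluation of an element of `L^p` at `k` points, along a given evaluation map. -/
def evalPow {X E L : Type*} (Φ : X × L → E) (k : ℕ) (z : (Fin k → X) × L) : Fin k → E :=
  fun i => Φ (z.1 i, z.2)

theorem measurable_evalPow {X E L : Type*} [MeasurableSpace X] [MeasurableSpace E]
    [MeasurableSpace L] {Φ : X × L → E} (hΦ : Measurable Φ) (k : ℕ) :
    Measurable (evalPow Φ k) :=
  measurable_pi_lambda _ fun i =>
    hΦ.comp (((measurable_pi_apply i).comp measurable_fst).prodMk measurable_snd)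

theorem isFiniteMeasure_restrict_of_isBounded {d : ℕ} {D : Set (EuclideanSpace ℝ (Fin d))}
    (hD : Bornology.IsBounded D) : IsFiniteMeasure (volume.restrict D) :=
  ⟨by simpa using hD.measure_lt_top⟩

/-- The correlation measure dual to `μ` is the law of the point values under `μ`. -/
theorem ae_eq_map_evalPow {d N : ℕ} {D : Set (EuclideanSpace ℝ (Fin d))}
    (hDb : Bornology.IsBounded D) {p : ℝ≥0∞} [Fact (1 ≤ p)]
    {μ : Measure (LpDom D N p)} [IsProbabilityMeasure μ] {ν : MarginalFamily d N}
    (hν : IsCorrelationMeasure D p.toReal ν) (hdual : IsDualTo D p ν μ)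
    {Φ : EuclideanSpace ℝ (Fin d) × LpDom D N p → EuclideanSpace ℝ (Fin N)}
    (hΦ : Measurable Φ) (hΦu : ∀ u : LpDom D N p, ∀ᵐ x ∂volume.restrict D, Φ (x, u) = u x)
    {k : ℕ} (hk : 1 ≤ k) :
    ∀ᵐ x ∂volPow D k, ν k x = μ.map fun u => evalPow Φ k (x, u) := by
  have := isFiniteMeasure_restrict_of_isBounded hDb
  have hfin : IsFiniteMeasure (volPow D k) := by unfold volPow; infer_instance
  have hev := measurable_evalPow hΦ k
  have hevx : ∀ x, Measurable fun u => evalPow Φ k (x, u) := fun x =>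
    hev.comp measurable_prodMk_left
  have hmap : ∀ (f : C₀(Fin k → EuclideanSpace ℝ (Fin N), ℝ)) x,
      ∫ y, f y ∂(μ.map fun u => evalPow Φ k (x, u)) = ∫ u, f (evalPow Φ k (x, u)) ∂μ := fun f x =>
    integral_map (hevx x).aemeasurable f.continuous.aestronglyMeasurable
  have hfm : ∀ f : C₀(Fin k → EuclideanSpace ℝ (Fin N), ℝ),
      StronglyMeasurable fun z => f (evalPow Φ k z) := fun f =>
    (f.continuous.measurable.comp hev).stronglyMeasurable
  refine ae_eq_of_setIntegral_C₀_eq (hν.prob k hk)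
    (ae_of_all _ fun x => Measure.isProbabilityMeasure_map (hevx x).aemeasurable)
    (fun f => hν.meas k hk f.toBCF) (fun f => ?_) fun f A hA => ?_
  · simp only [hmap]
    exact (hfm f).integral_prod_right'.measurable.aemeasurable
  -- The null set depends on u, which is harmless: the dual side integrates in x first, for fixed u.
  · have hpt : ∀ u : LpDom D N p, ∀ᵐ x ∂volPow D k, evalPow Φ k (x, u) = fun i => u (x i) := by
      intro u
      have h : ∀ᵐ x ∂volPow D k, ∀ i, Φ (x i, u) = u (x i) := ae_all_iff.2 fun i =>
        (Measure.tendsto_eval_ae_ae (μ := fun _ : Fin k => volume.restrict D)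
          (i := i)).eventually (hΦu u)
      filter_upwards [h] with x hx
      exact funext hx
    have hd := hdual k hk (A.indicator fun _ => f) ((integrable_const f).indicator hA)
    have h1 : ∀ x, ∫ ξ, (A.indicator (fun _ => f) x) ξ ∂(ν k x) =
        A.indicator (fun x => ∫ ξ, f ξ ∂(ν k x)) x := by
      intro x
      by_cases hx : x ∈ A <;> simp [hx]
    have h2 : ∀ u : LpDom D N p,
        ∫ x, (A.indicator (fun _ => f) x) (fun i => u (x i)) ∂(volPow D k) =
          ∫ x in A, f (evalPow Φ k (x, u)) ∂(volPow D k) := by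
      intro u
      rw [← integral_indicator hA]
      refine integral_congr_ae ?_
      filter_upwards [hpt u] with x hx
      by_cases hxA : x ∈ A <;> simp [hxA, hx]
    simp only [h1, h2] at hd
    rw [integral_indicator hA] at hd
    rw [hd]
    simp only [hmap]
    refine integral_integral_swap ?_
    refine Integrable.of_bound ((hfm f).comp_measurable measurable_swap).aestronglyMeasurable ‖f‖
      (ae_of_all _ fun z => f.toBCF.norm_coe_le_norm _)

/-! ### Transport cost of the point values. -/

/-- Integrating a function of one coordinate over `D^k`. -/
theorem lintegral_volPow_eval {d : ℕ} {D : Set (EuclideanSpace ℝ (Fin d))}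
    (hDb : Bornology.IsBounded D) {k : ℕ} (i : Fin k) {f : EuclideanSpace ℝ (Fin d) → ℝ≥0∞}
    (hf : Measurable f) :
    ∫⁻ x, f (x i) ∂(volPow D k) = volume D ^ (k - 1) * ∫⁻ x in D, f x := by
  classical
  have := isFiniteMeasure_restrict_of_isBounded hDb
  have h := Measure.pi_map_eval (fun _ : Fin k => volume.restrict D) i
  rw [Finset.prod_const, Finset.card_erase_of_mem (Finset.mem_univ i), Finset.card_univ,
    Fintype.card_fin, Measure.restrict_apply_univ] at h
  rw [← smul_eq_mul, ← lintegral_smul_measure, ← h,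
    lintegral_map hf (measurable_pi_apply i)]
  rfl

/-- A vector is the sum of its one-coordinate parts, whose norms do not depend on q; this keeps q
out of the final constant. -/
theorem enorm_piLp_le_sum {ι E : Type*} [Fintype ι] [SeminormedAddCommGroup E] (q : ℝ≥0∞)
    [Fact (1 ≤ q)] (x : PiLp q fun _ : ι => E) : ‖x‖ₑ ≤ ∑ i, ‖x i‖ₑ := by
  classical
  let y : ι → PiLp q fun _ : ι => E := fun i => PiLp.single q i (x i)
  have h : ∑ i, y i = x := by
    ext j
    simp [y, WithLp.ofLp_sum, Finset.sum_apply, Pi.single_apply]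
  have hy : ∀ i, ‖y i‖₊ = ‖x i‖₊ := fun i => PiLp.nnnorm_single q (fun _ : ι => E) i (x i)
  have h' : ‖x‖₊ ≤ ∑ i, ‖x i‖₊ := by
    simpa only [h, hy] using nnnorm_sum_le Finset.univ y
  rw [enorm_eq_nnnorm]
  simp only [enorm_eq_nnnorm, ← ENNReal.ofNNReal_finsetSum]
  exact ENNReal.coe_le_coe.2 h'

/-- Evaluation of an element of `L^p` at `k` points, in `E^k` with the `ℓ^q` norm. -/
def evalPiLp {X E L : Type*} (q : ℝ≥0∞) (Φ : X × L → E) (k : ℕ) (z : (Fin k → X) × L) :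
    PiLp q fun _ : Fin k => E :=
  WithLp.toLp q (evalPow Φ k z)

theorem measurable_evalPiLp {X E L : Type*} [MeasurableSpace X] [MeasurableSpace E]
    [MeasurableSpace L] (q : ℝ≥0∞) {Φ : X × L → E} (hΦ : Measurable Φ) (k : ℕ) :
    Measurable (evalPiLp q Φ k) :=
  (WithLp.measurable_toLp _ _).comp (measurable_evalPow hΦ k)

theorem wassersteinPow_map_evalPow {X L : Type*} [MeasurableSpace X] [MeasurableSpace L] {N : ℕ}
    (q : ℝ≥0∞) [Fact (1 ≤ q)] {Φ : X × L → EuclideanSpace ℝ (Fin N)} (hΦ : Measurable Φ) (k : ℕ)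
    (μ μ' : Measure L) (r : ℝ) (x : Fin k → X) :
    wassersteinPow q r (μ.map fun u => evalPow Φ k (x, u)) (μ'.map fun u => evalPow Φ k (x, u)) =
      wasserstein r (μ.map fun u => evalPiLp q Φ k (x, u))
        (μ'.map fun u => evalPiLp q Φ k (x, u)) := by
  have h : Measurable fun u => evalPow Φ k (x, u) :=
    (measurable_evalPow hΦ k).comp measurable_prodMk_left
  rw [wassersteinPow, Measure.map_map (WithLp.measurable_toLp _ _) h,
    Measure.map_map (WithLp.measurable_toLp _ _) h]
  rfl

theorem IsTransportPlan.isProbabilityMeasure {X : Type*} [MeasurableSpace X]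
    {π : Measure (X × X)} {μ ρ : Measure X} [IsProbabilityMeasure μ] (h : IsTransportPlan π μ ρ) :
    IsProbabilityMeasure π := by
  have : IsProbabilityMeasure (π.map Prod.fst) := by rw [h.1]; infer_instance
  exact Measure.isProbabilityMeasure_of_map Prod.fst

theorem IsTransportPlan.map {X Z : Type*} [MeasurableSpace X] [MeasurableSpace Z]
    {π : Measure (X × X)} {μ ρ : Measure X} (h : IsTransportPlan π μ ρ) {f : X → Z}
    (hf : Measurable f) : IsTransportPlan (π.map (Prod.map f f)) (μ.map f) (ρ.map f) := by
  constructor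
  · rw [Measure.map_map measurable_fst (hf.prodMap hf), ← h.1,
      Measure.map_map hf measurable_fst]
    rfl
  · rw [Measure.map_map measurable_snd (hf.prodMap hf), ← h.2,
      Measure.map_map hf measurable_snd]
    rfl

theorem isTransportPlan_prod {X : Type*} [MeasurableSpace X] (μ ρ : Measure X)
    [IsProbabilityMeasure μ] [IsProbabilityMeasure ρ] : IsTransportPlan (μ.prod ρ) μ ρ :=
  ⟨Measure.fst_prod, Measure.snd_prod⟩

theorem wasserstein_rpow_le {X : Type*} [NormedAddCommGroup X] [MeasurableSpace X] {p : ℝ}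
    (hp : 0 < p) {μ ρ : Measure X} {π : Measure (X × X)} (h : IsTransportPlan π μ ρ) :
    wasserstein p μ ρ ^ p ≤ ∫⁻ z, ‖z.1 - z.2‖ₑ ^ p ∂π := by
  rw [wasserstein, ← ENNReal.rpow_mul, one_div_mul_cancel hp.ne', ENNReal.rpow_one]
  exact iInf₂_le π h

section

variable {d N k : ℕ} {D : Set (EuclideanSpace ℝ (Fin d))} {p : ℝ≥0∞} [Fact (1 ≤ p)]
  (q : ℝ≥0∞) [Fact (1 ≤ q)]
  {Φ : EuclideanSpace ℝ (Fin d) × LpDom D N p → EuclideanSpace ℝ (Fin N)}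

/-- The Wasserstein distance between the laws of the point values is measurable. -/
theorem measurable_wassersteinPow_map_evalPow (hΦ : Measurable Φ) (μ μ' : Measure (LpDom D N p))
    [IsProbabilityMeasure μ] [IsProbabilityMeasure μ'] {r : ℝ} (hr : 0 ≤ r) :
    Measurable fun x => wassersteinPow q r (μ.map fun u => evalPow Φ k (x, u))
      (μ'.map fun u => evalPow Φ k (x, u)) := by
  simp only [wassersteinPow_map_evalPow q hΦ]
  have hf := measurable_evalPiLp q hΦ k
  have hfx : ∀ x, Measurable fun u => evalPiLp q Φ k (x, u) := fun x =>
    hf.comp measurable_prodMk_left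
  have hg : Measurable fun z : (Fin k → EuclideanSpace ℝ (Fin d)) × (LpDom D N p × LpDom D N p) =>
      (evalPiLp q Φ k (z.1, z.2.1), evalPiLp q Φ k (z.1, z.2.2)) :=
    (hf.comp (measurable_fst.prodMk (measurable_fst.comp measurable_snd))).prodMk
      (hf.comp (measurable_fst.prodMk (measurable_snd.comp measurable_snd)))
  -- The product coupling only serves to carry both marginals in one measurable map.
  let ρ : (Fin k → EuclideanSpace ℝ (Fin d)) → ProbabilityMeasure
      ((PiLp q fun _ : Fin k => EuclideanSpace ℝ (Fin N)) ×
        (PiLp q fun _ : Fin k => EuclideanSpace ℝ (Fin N))) := fun x =>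
    ⟨(μ.prod μ').map (Prod.map (fun u => evalPiLp q Φ k (x, u)) fun u => evalPiLp q Φ k (x, u)),
      Measure.isProbabilityMeasure_map ((hfx x).prodMap (hfx x)).aemeasurable⟩
  have hρ : Measurable ρ := by
    refine Measurable.subtype_mk (Measure.measurable_of_measurable_coe _ fun s hs => ?_)
    simp only [fun x => Measure.map_apply (μ := μ.prod μ') ((hfx x).prodMap (hfx x)) hs]
    exact measurable_measure_prodMk_left (ν := μ.prod μ') (hg hs)
  have h := (measurable_wasserstein_marginals hr).comp hρ
  refine (congrArg Measurable (funext fun x => ?_)).mp h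
  have hplan := (isTransportPlan_prod μ μ').map (hfx x)
  change wasserstein r (((μ.prod μ').map _).map Prod.fst) (((μ.prod μ').map _).map Prod.snd) = _
  rw [hplan.1, hplan.2]

/-- The cost of the point values of a pair of functions, integrated over `D^k`. -/
theorem lintegral_enorm_evalPow_sub_le (hDb : Bornology.IsBounded D) (hp : p ≠ ∞)
    (hΦ : Measurable Φ) (hΦu : ∀ u : LpDom D N p, ∀ᵐ x ∂volume.restrict D, Φ (x, u) = u x)
    (u v : LpDom D N p) :
    ∫⁻ x, ‖evalPiLp q Φ k (x, u) - evalPiLp q Φ k (x, v)‖ₑ ^ p.toReal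
      ∂(volPow D k) ≤ (k : ℝ≥0∞) ^ p.toReal * volume D ^ (k - 1) * ‖u - v‖ₑ ^ p.toReal := by
  have hp1 : (1 : ℝ≥0∞) ≤ p := Fact.out
  have hp0 : 0 < p.toReal := ENNReal.toReal_pos (zero_lt_one.trans_le hp1).ne' hp
  have hp1' : 1 ≤ p.toReal := (ENNReal.dichotomy p).resolve_left hp
  have hm : Measurable fun x => ‖Φ (x, u) - Φ (x, v)‖ₑ ^ p.toReal :=
    (((hΦ.comp measurable_prodMk_right).sub (hΦ.comp measurable_prodMk_right)).enorm).pow_const _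
  have hnorm : ∫⁻ x in D, ‖Φ (x, u) - Φ (x, v)‖ₑ ^ p.toReal = ‖u - v‖ₑ ^ p.toReal := by
    rw [Lp.enorm_def, eLpNorm_eq_lintegral_rpow_enorm_toReal (zero_lt_one.trans_le hp1).ne' hp,
      ← ENNReal.rpow_mul, one_div_mul_cancel hp0.ne', ENNReal.rpow_one]
    refine lintegral_congr_ae ?_
    filter_upwards [Lp.coeFn_sub u v, hΦu u, hΦu v] with x hx hu hv
    rw [hx, Pi.sub_apply, hu, hv]
  calc _ ≤ ∫⁻ x, (k : ℝ≥0∞) ^ (p.toReal - 1) *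
        ∑ i : Fin k, ‖Φ (x i, u) - Φ (x i, v)‖ₑ ^ p.toReal ∂(volPow D k) := by
        refine lintegral_mono fun x => ?_
        -- Power mean inequality: (∑ a_i)^p ≤ k^(p-1) ∑ a_i^p.
        refine (ENNReal.rpow_le_rpow (enorm_piLp_le_sum q _) hp0.le).trans ?_
        simpa [evalPiLp, evalPow] using ENNReal.rpow_sum_le_const_mul_sum_rpow Finset.univ
          (fun i : Fin k => ‖Φ (x i, u) - Φ (x i, v)‖ₑ) hp1'
    _ = (k : ℝ≥0∞) ^ (p.toReal - 1) *
        ∑ i : Fin k, volume D ^ (k - 1) * ‖u - v‖ₑ ^ p.toReal := by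
        have hmi : ∀ i : Fin k, Measurable fun x : Fin k → EuclideanSpace ℝ (Fin d) =>
            ‖Φ (x i, u) - Φ (x i, v)‖ₑ ^ p.toReal := fun i => hm.comp (measurable_pi_apply i)
        rw [lintegral_const_mul _ (Finset.measurable_sum _ fun i _ => hmi i),
          lintegral_finsetSum _ fun i _ => hmi i]
        simp only [lintegral_volPow_eval hDb _ hm, hnorm]
    _ ≤ (k : ℝ≥0∞) ^ p.toReal * volume D ^ (k - 1) * ‖u - v‖ₑ ^ p.toReal := by
        rw [Finset.sum_const, Finset.card_univ, Fintype.card_fin, nsmul_eq_mul, ← mul_assoc,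
          ← mul_assoc]
        gcongr
        rcases Nat.eq_zero_or_pos k with rfl | hk
        · simp
        · have hk0 : (k : ℝ≥0∞) ≠ 0 := by exact_mod_cast hk.ne'
          conv_lhs => rw [← ENNReal.rpow_one (k : ℝ≥0∞), ← ENNReal.rpow_mul, one_mul,
            ← ENNReal.rpow_add _ _ hk0 (ENNReal.natCast_ne_top k)]
          rw [sub_add_cancel]

end

/-! ### The Wasserstein estimate. -/

theorem mainTheorem10 :
    -- the constant, as a function of `p`, `k` and `|D|`
    ∃ C : ℝ≥0∞ → ℕ → ℝ≥0∞ → ℝ≥0,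
      ∀ (p : ℝ≥0∞) [Fact (1 ≤ p)], p ≠ ∞ →
      ∀ (q : ℝ≥0∞) [Fact (1 ≤ q)] (k : ℕ), 1 ≤ k →
      ∀ (d N : ℕ) (D : Set (EuclideanSpace ℝ (Fin d))),
        MeasurableSet D → Bornology.IsBounded D →
      ∀ (μ μ' : Measure (LpDom D N p)) [IsProbabilityMeasure μ] [IsProbabilityMeasure μ'],
        ∫⁻ u, ‖u‖ₑ ^ p.toReal ∂μ < ∞ → ∫⁻ u, ‖u‖ₑ ^ p.toReal ∂μ' < ∞ →
      ∀ ν ν' : MarginalFamily d N,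
        IsCorrelationMeasure D p.toReal ν → IsDualTo D p ν μ →
        IsCorrelationMeasure D p.toReal ν' → IsDualTo D p ν' μ' →
        AEMeasurable (fun x => wassersteinPow q p.toReal (ν k x) (ν' k x)) (volPow D k) ∧
        (∫⁻ x, wassersteinPow q p.toReal (ν k x) (ν' k x) ^ p.toReal ∂(volPow D k)) ^
            (1 / p.toReal) ≤
          C p k (volume D) * wasserstein p.toReal μ μ' := by
  refine ⟨fun p k V => ((k : ℝ≥0∞) ^ p.toReal * V ^ (k - 1)).toNNReal ^ (1 / p.toReal), ?_⟩
  intro p _ hp q _ k hk d N D _ hDb μ μ' _ _ _ _ ν ν' hν hνμ hν' hνμ'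
  have hp1 : (1 : ℝ≥0∞) ≤ p := Fact.out
  have hp0 : 0 < p.toReal := ENNReal.toReal_pos (zero_lt_one.trans_le hp1).ne' hp
  have := isFiniteMeasure_restrict_of_isBounded hDb
  have hfin : IsFiniteMeasure (volPow D k) := by unfold volPow; infer_instance
  have : Fact (p ≠ ∞) := ⟨hp⟩
  obtain ⟨Φ, hΦ, hΦu⟩ := exists_measurable_lp_eval (E := EuclideanSpace ℝ (Fin N)) hp
    (μ := volume.restrict D)
  have hev := measurable_evalPiLp q hΦ k
  have h := ae_eq_map_evalPow hDb hν hνμ hΦ hΦu hk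
  have h' := ae_eq_map_evalPow hDb hν' hνμ' hΦ hΦu hk
  refine ⟨(measurable_wassersteinPow_map_evalPow q hΦ μ μ' hp0.le).aemeasurable.congr ?_, ?_⟩
  · filter_upwards [h, h'] with x hx hx'
    rw [hx, hx']
  have hC : (k : ℝ≥0∞) ^ p.toReal * volume D ^ (k - 1) ≠ ∞ :=
    ENNReal.mul_ne_top (ENNReal.rpow_ne_top_of_nonneg hp0.le (ENNReal.natCast_ne_top k))
      (ENNReal.pow_ne_top hDb.measure_lt_top.ne)
  rw [ENNReal.coe_rpow_of_nonneg _ (by positivity), ENNReal.coe_toNNReal hC, wasserstein,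
    ← ENNReal.mul_rpow_of_nonneg _ _ (by positivity)]
  refine ENNReal.rpow_le_rpow ?_ (by positivity)
  have key : ∀ π : Measure (LpDom D N p × LpDom D N p), IsTransportPlan π μ μ' →
      ∫⁻ x, wassersteinPow q p.toReal (ν k x) (ν' k x) ^ p.toReal ∂(volPow D k) ≤
        (k : ℝ≥0∞) ^ p.toReal * volume D ^ (k - 1) * ∫⁻ z, ‖z.1 - z.2‖ₑ ^ p.toReal ∂π := by
    intro π hπ
    have := hπ.isProbabilityMeasure
    have hc : Measurable fun z : (Fin k → EuclideanSpace ℝ (Fin d)) ×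
        (LpDom D N p × LpDom D N p) =>
          ‖evalPiLp q Φ k (z.1, z.2.1) - evalPiLp q Φ k (z.1, z.2.2)‖ₑ ^ p.toReal :=
      (((hev.comp (measurable_fst.prodMk (measurable_fst.comp measurable_snd))).sub
        (hev.comp (measurable_fst.prodMk (measurable_snd.comp measurable_snd)))).enorm).pow_const _
    calc _ ≤ ∫⁻ x, ∫⁻ z, ‖evalPiLp q Φ k (x, z.1) - evalPiLp q Φ k (x, z.2)‖ₑ ^ p.toReal ∂π
          ∂(volPow D k) := by
          refine lintegral_mono_ae ?_
          filter_upwards [h, h'] with x hx hx'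
          have hfx : Measurable fun u => evalPiLp q Φ k (x, u) := hev.comp measurable_prodMk_left
          rw [hx, hx', wassersteinPow_map_evalPow q hΦ]
          refine (wasserstein_rpow_le hp0 (hπ.map hfx)).trans_eq ?_
          exact lintegral_map (((measurable_fst.sub measurable_snd).enorm).pow_const _)
            (hfx.prodMap hfx)
      _ = ∫⁻ z, ∫⁻ x, ‖evalPiLp q Φ k (x, z.1) - evalPiLp q Φ k (x, z.2)‖ₑ ^ p.toReal
          ∂(volPow D k) ∂π := lintegral_lintegral_swap hc.aemeasurable
      _ ≤ ∫⁻ z, (k : ℝ≥0∞) ^ p.toReal * volume D ^ (k - 1) * ‖z.1 - z.2‖ₑ ^ p.toReal ∂π :=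
          lintegral_mono fun z => lintegral_enorm_evalPow_sub_le q hDb hp hΦ hΦu z.1 z.2
      _ = _ := lintegral_const_mul' _ _ hC
  -- The constant may be 0 (|D| = 0, k ≥ 2); moving it inside the infimum then requires that a plan
  -- exist.
  have : Nonempty {π // IsTransportPlan π μ μ'} := ⟨⟨_, isTransportPlan_prod μ μ'⟩⟩
  rw [iInf_subtype', ENNReal.mul_iInf fun h _ => absurd h hC]
  exact le_iInf fun π => key π.1 π.2
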